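/- Let $n\ge 1$ and let $a_1,\dots,a_n,b_1,\dots,b_n$ be real numbers with $0\le a_ib_j<1$ for all $i,j$. Let $x_{i,j}$ $(1\le i,j\le n)$ be independent random variables with the geometric distributions $$\Pr(x_{i,j}=k)=(1-a_ib_j)(a_ib_j)^k,\qquad k=0,1,2,\dots .$$ Let $L_n$ be the last passage time $$L_n=\max_{\pi}\sum_{(i,j)\in\pi}x_{i,j},$$ where the maximum is over all lattice paths $\pi$ from $(1,1)$ to $(n,n)$ each of whose steps goes one unit up or one unit to the right. Then for every integer $l\ge 0$ $$\Pr(L_n\le l)=\prod_{i,j=1}^n(1-a_ib_j)\,\Big\langle\prod_{j=1}^n\prod_{k=1}^l(1+a_je^{-i\theta_k})(1+b_je^{i\theta_k})\Big\rangle_{U(l)},$$ where $\langle F\rangle_{U(l)}$ is the average of $F$ over the eigenvalue angles of a uniformly distributed matrix in $U(l)$, that is, $$\langle F\rangle_{U(l)}=\frac{1}{(2\pi)^l\,l!}\int_{[0,2\pi]^l}F(\theta_1,\dots,\theta_l)\prod_{1\le j<k\le l}|e^{i\theta_k}-e^{i\theta_j}|^2\,d\theta_1\cdots d\theta_l .$$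 -/

import Mathlib

namespace JohanssonModel

/-- A single lattice step in the `n × n` square: one unit in the first coordinate or one unit in
the second coordinate (coordinates run over `0, …, n - 1` instead of `1, …, n`). -/
def Step {n : ℕ} (p q : Fin n × Fin n) : Prop :=
  ((p.1 : ℕ) + 1 = q.1 ∧ p.2 = q.2) ∨ (p.1 = q.1 ∧ (p.2 : ℕ) + 1 = q.2)

/-- The list of sites visited by an up / right-horizontal lattice path from the bottom left corner
to the top right corner of the `n × n` square. -/
def IsUpRightPath {n : ℕ} [NeZero n] (p : List (Fin n × Fin n)) : Prop :=
  p.head? = some (0, 0) ∧ p.getLast? = some (⊤, ⊤) ∧ p.IsChain Step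

/-- The set of all sums of the entries of `x` along up / right-horizontal paths. -/
def pathSums {n : ℕ} [NeZero n] (x : Fin n → Fin n → ℕ) : Set ℕ :=
  {s | ∃ p : List (Fin n × Fin n), IsUpRightPath p ∧ s = (p.map fun q => x q.1 q.2).sum}

/-- The last passage time: the maximum of the path sums
(a genuine maximum, see `isGreatest_lastPassageTime`). -/
noncomputable def lastPassageTime {n : ℕ} [NeZero n] (x : Fin n → Fin n → ℕ) : ℕ :=
  sSup (pathSums x)

theorem Step.lt {n : ℕ} {p q : Fin n × Fin n} (h : Step p q) : p < q := by
  rw [Prod.lt_iff]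
  rcases h with ⟨h1, h2⟩ | ⟨h1, h2⟩
  · left; exact ⟨by rw [Fin.lt_def]; omega, h2.le⟩
  · right; exact ⟨h1.le, by rw [Fin.lt_def]; omega⟩

theorem bddAbove_pathSums {n : ℕ} [NeZero n] (x : Fin n → Fin n → ℕ) :
    BddAbove (pathSums x) := by
  refine ⟨∑ q : Fin n × Fin n, x q.1 q.2, ?_⟩
  rintro s ⟨p, ⟨-, -, hp⟩, rfl⟩
  have hlt : p.IsChain (· < ·) := hp.imp fun _ _ h => h.lt
  have hnd : p.Nodup := (List.isChain_iff_pairwise.1 hlt).imp fun h => ne_of_lt h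
  rw [← List.sum_toFinset _ hnd]
  exact Finset.sum_le_sum_of_subset (Finset.subset_univ _)

theorem exists_path {n : ℕ} [NeZero n] : ∀ (m : ℕ) (q : Fin n × Fin n),
    (q.1 : ℕ) + q.2 = m →
    ∃ p : List (Fin n × Fin n), p.head? = some (0, 0) ∧ p.getLast? = some q ∧ p.IsChain Step := by
  intro m
  induction m with
  | zero =>
    intro q hq
    refine ⟨[(0, 0)], rfl, ?_, by simp⟩
    have : q = (0, 0) := by
      have h1 : (q.1 : ℕ) = 0 := by omega
      have h2 : (q.2 : ℕ) = 0 := by omega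
      ext
      · simpa using h1
      · simpa using h2
    simp [this]
  | succ m ih =>
    intro q hq
    have : ∃ r : Fin n × Fin n, (r.1 : ℕ) + r.2 = m ∧ Step r q := by
      by_cases h : (q.1 : ℕ) = 0
      · exact ⟨(q.1, ⟨q.2 - 1, by omega⟩), by simp; omega, Or.inr ⟨rfl, by simp; omega⟩⟩
      · exact ⟨(⟨q.1 - 1, by omega⟩, q.2), by simp; omega, Or.inl ⟨by simp; omega, rfl⟩⟩
    obtain ⟨r, hr, hs⟩ := this
    obtain ⟨p, h1, h2, h3⟩ := ih r hr
    refine ⟨p ++ [q], by simp [h1], by simp, ?_⟩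
    rw [List.isChain_append]
    refine ⟨h3, by simp, ?_⟩
    intro y hy z hz
    rw [h2] at hy
    simp at hy hz
    subst hy hz
    exact hs

theorem isGreatest_lastPassageTime {n : ℕ} [NeZero n] (x : Fin n → Fin n → ℕ) :
    IsGreatest (pathSums x) (lastPassageTime x) := by
  obtain ⟨p, hp⟩ := exists_path (n := n) _ (⊤, ⊤) rfl
  exact ⟨Nat.sSup_mem ⟨_, p, hp, rfl⟩ (bddAbove_pathSums x),
    fun s hs => le_csSup (bddAbove_pathSums x) hs⟩

/-- The eigenvalue probability density of a uniformly distributed matrix in `U(l)`, as a function of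
the eigenvalue angles `θ ∈ [0, 2π]^l`:
`(1 / ((2π)^l l!)) ∏_{j < k} |e^{iθ_k} - e^{iθ_j}|²`. -/
noncomputable def unitaryDensity (l : ℕ) (θ : Fin l → ℝ) : ℝ :=
  1 / ((2 * Real.pi) ^ l * (Nat.factorial l : ℝ)) *
    ∏ j : Fin l, ∏ k ∈ Finset.Ioi j,
      ‖Complex.exp (Complex.I * (θ k : ℂ)) - Complex.exp (Complex.I * (θ j : ℂ))‖ ^ 2

/-- The average `⟨F(θ_1, …, θ_l)⟩_{U(l)}` over the eigenvalue angles. -/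
noncomputable def unitaryAverage (l : ℕ) (F : (Fin l → ℝ) → ℂ) : ℂ :=
  ∫ θ in Set.Icc (0 : Fin l → ℝ) (fun _ => 2 * Real.pi), F θ * (unitaryDensity l θ : ℂ)

end JohanssonModel

/-! Apart from the factor `∏ (1 - a i * b j)`, both sides equal the truncated Cauchy sum of `s_λ(a)
s_λ(b)` over partitions `λ` with `λ₁ ≤ l`. The Schur polynomial `s_λ` enters only as the total
`chainWeight` of the chains of horizontal strips from `∅` to `λ`.

Probability side: a matrix `x` has probability `∏ (1 - a i * b j) (a i * b j) ^ x i j`, so the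
monomials of all `x` with last passage time at most `l` have to be summed. The
Robinson-Schensted-Knuth correspondence, built as a growth diagram from an invertible local rule on
unit squares, sends `x` to two chains with the same final shape. The first row of the diagrams obeys
the recursion of last passage percolation, so `L_n` is the first row of that shape
(`lastPassageTime_eq_rowLen_growth`). The sizes record row and column sums of `x`, so weights match
(`sum_growth_eq_sum_stripChains`).

Unitary side: the density is a constant times a Vandermonde determinant in `e^{-iθ}` times one in
`e^{iθ}`. Multiplying a Vandermonde determinant by the factors `1 + b j * z k` and applying the
Pieri rule repeatedly gives a sum over chains of alternants indexed by the conjugate shape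
(`prod_mul_vandermonde_eq_sum_stripChains`). Conjugation turns the bound of `l` columns into the
number of variables. Orthogonality of alternants then keeps exactly the pairs of chains with equal
final shape (`unitaryAverage_eq_sum_stripChains`). -/

namespace YoungDiagram

/-! ### Young diagrams and horizontal strips in terms of row and column lengths -/

/-- `IsHorizontalStrip μ ν` says that `μ ⊆ ν` and that `ν / μ` has at most one cell in each
column. -/
def IsHorizontalStrip (μ ν : YoungDiagram) : Prop :=
  μ ≤ ν ∧ ∀ i j, (i + 1, j) ∈ ν → (i, j) ∈ μ

theorem le_iff_rowLen {μ ν : YoungDiagram} : μ ≤ ν ↔ ∀ i, μ.rowLen i ≤ ν.rowLen i := by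
  constructor
  · intro h i
    by_contra! hlt
    exact (mem_iff_lt_rowLen.1 (h (mem_iff_lt_rowLen.2 hlt))).false
  · rintro h ⟨i, j⟩ hij
    exact mem_iff_lt_rowLen.2 ((mem_iff_lt_rowLen.1 hij).trans_le (h i))

theorem ext_rowLen {μ ν : YoungDiagram} (h : ∀ i, μ.rowLen i = ν.rowLen i) : μ = ν :=
  le_antisymm (le_iff_rowLen.2 fun i => (h i).le) (le_iff_rowLen.2 fun i => (h i).ge)

theorem ext_colLen {μ ν : YoungDiagram} (h : ∀ j, μ.colLen j = ν.colLen j) : μ = ν := by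
  rw [← transpose_eq_iff]
  exact ext_rowLen fun i => by simpa using h i

theorem isHorizontalStrip_iff_rowLen {μ ν : YoungDiagram} :
    IsHorizontalStrip μ ν ↔ ∀ i, μ.rowLen i ≤ ν.rowLen i ∧ ν.rowLen (i + 1) ≤ μ.rowLen i := by
  rw [IsHorizontalStrip, le_iff_rowLen, forall_and]
  refine and_congr Iff.rfl (forall_congr' fun i => ?_)
  simp only [mem_iff_lt_rowLen]
  exact ⟨fun h => le_of_not_gt fun hlt => (h _ hlt).false, fun h j hj => hj.trans_le h⟩

/-- The binary choice in each column is what later matches the expansion of `∏ (1 + b * z k)`; the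
interlacing form in rows serves the local rule. -/
theorem isHorizontalStrip_iff_colLen {μ ν : YoungDiagram} :
    IsHorizontalStrip μ ν ↔ ∀ j, μ.colLen j ≤ ν.colLen j ∧ ν.colLen j ≤ μ.colLen j + 1 := by
  rw [IsHorizontalStrip, ← transpose_le_iff, le_iff_rowLen, forall_and]
  simp only [rowLen_transpose]
  refine and_congr Iff.rfl ?_
  rw [forall_comm]
  refine forall_congr' fun j => ?_
  simp only [mem_iff_lt_colLen]
  constructor
  · intro h
    by_contra! hlt
    exact (h (μ.colLen j) hlt).false
  · intro h i hi
    omega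

theorem rowLen_eq_zero_iff {μ : YoungDiagram} {i : ℕ} : μ.rowLen i = 0 ↔ μ.colLen 0 ≤ i := by
  have := mem_iff_lt_rowLen (μ := μ) (i := i) (j := 0)
  rw [mem_iff_lt_colLen] at this
  omega

theorem colLen_eq_zero_iff {μ : YoungDiagram} {j : ℕ} : μ.colLen j = 0 ↔ μ.rowLen 0 ≤ j := by
  have := mem_iff_lt_rowLen (μ := μ) (i := 0) (j := j)
  rw [mem_iff_lt_colLen] at this
  omega

@[simp] theorem rowLen_bot (i : ℕ) : (⊥ : YoungDiagram).rowLen i = 0 := by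
  by_contra h
  exact notMem_bot _ (mem_iff_lt_rowLen.2 (Nat.pos_of_ne_zero h))

@[simp] theorem colLen_bot (i : ℕ) : (⊥ : YoungDiagram).colLen i = 0 := by
  by_contra h
  exact notMem_bot _ (mem_iff_lt_colLen.2 (Nat.pos_of_ne_zero h))

theorem card_eq_sum_rowLen (μ : YoungDiagram) {N : ℕ} (hN : μ.colLen 0 ≤ N) :
    μ.card = ∑ i ∈ Finset.range N, μ.rowLen i := by
  rw [YoungDiagram.card, Finset.card_eq_sum_card_fiberwise (f := Prod.fst) (t := Finset.range N)]
  · exact Finset.sum_congr rfl fun i _ => (μ.rowLen_eq_card (i := i)).symm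
  · rintro ⟨i, j⟩ h
    have h' := μ.up_left_mem le_rfl (Nat.zero_le j) h
    rw [mem_iff_lt_colLen] at h'
    simpa using h'.trans_le hN

@[simp] theorem card_transpose (μ : YoungDiagram) : μ.transpose.card = μ.card := by
  simp [YoungDiagram.card, transpose]

theorem card_eq_sum_colLen (μ : YoungDiagram) {N : ℕ} (hN : μ.rowLen 0 ≤ N) :
    μ.card = ∑ i ∈ Finset.range N, μ.colLen i := by
  rw [← card_transpose, card_eq_sum_rowLen (N := N) _ (by simpa using hN)]
  simp

/-- The Young diagram with row lengths `f 0, …, f (N - 1)`, when these decrease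
(in general, the largest Young diagram with at most these row lengths). -/
def ofRows (f : ℕ → ℕ) (N : ℕ) : YoungDiagram where
  cells := (Finset.range N ×ˢ Finset.range (f 0)).filter fun c => ∀ i ≤ c.1, c.2 < f i
  isLowerSet := by
    rintro ⟨i, j⟩ ⟨i', j'⟩ ⟨h1, h2⟩ h
    simp only [Finset.coe_filter, Finset.mem_product, Finset.mem_range,
      Set.mem_ofPred_eq] at h h1 h2 ⊢
    refine ⟨⟨by omega, by omega⟩, fun k hk => ?_⟩
    have := h.2 k (by omega)
    omega

theorem rowLen_ofRows {f : ℕ → ℕ} {N : ℕ} (hf : Antitone f) (hN : f N = 0) (i : ℕ) :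
    (ofRows f N).rowLen i = f i := by
  have key : ∀ j, j < (ofRows f N).rowLen i ↔ j < f i := by
    intro j
    rw [← mem_iff_lt_rowLen, ← mem_cells, ofRows, Finset.mem_filter, Finset.mem_product,
      Finset.mem_range, Finset.mem_range]
    constructor
    · exact fun h => h.2 i le_rfl
    · intro h
      refine ⟨⟨?_, h.trans_le (hf (Nat.zero_le i))⟩, fun k hk => h.trans_le (hf hk)⟩
      by_contra! hle
      have : f i ≤ f N := hf hle
      omega
  have h1 := key (f i)
  have h2 := key ((ofRows f N).rowLen i)
  omega

theorem exists_colLen_eq {f : ℕ → ℕ} {N : ℕ} (hf : Antitone f) (hN : f N = 0) :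
    ∃ μ : YoungDiagram, ∀ j, μ.colLen j = f j :=
  ⟨(ofRows f N).transpose, fun j => by rw [colLen_transpose, rowLen_ofRows hf hN]⟩

/-! ### The local rule of the Robinson-Schensted-Knuth correspondence -/

/-- The row lengths of the diagram produced by `localRule`. -/
def localRuleRow (κ μ ν : YoungDiagram) (k : ℕ) : ℕ → ℕ
  | 0 => max (μ.rowLen 0) (ν.rowLen 0) + k
  | i + 1 => max (μ.rowLen (i + 1)) (ν.rowLen (i + 1)) +
      (min (μ.rowLen i) (ν.rowLen i) - κ.rowLen i)

/-- The local rule: from the three diagrams `κ`, `μ`, `ν` at the corners of a unit square and the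
entry `k` of the square to the diagram at the fourth corner. -/
def localRule (κ μ ν : YoungDiagram) (k : ℕ) : YoungDiagram :=
  ofRows (localRuleRow κ μ ν k) (μ.colLen 0 + ν.colLen 0 + 1)

/-- The inverse of the local rule. -/
def localRuleInv (μ ν ρ : YoungDiagram) : YoungDiagram :=
  ofRows (fun i => max (μ.rowLen (i + 1)) (ν.rowLen (i + 1)) +
    (min (μ.rowLen i) (ν.rowLen i) - ρ.rowLen (i + 1))) (μ.colLen 0)

section LocalRule

variable {κ μ ν ρ : YoungDiagram} {k : ℕ}

theorem rowLen_localRule (hμ : IsHorizontalStrip κ μ) (hν : IsHorizontalStrip κ ν) :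
    (localRule κ μ ν k).rowLen 0 = max (μ.rowLen 0) (ν.rowLen 0) + k ∧
    ∀ i, (localRule κ μ ν k).rowLen (i + 1) =
      max (μ.rowLen (i + 1)) (ν.rowLen (i + 1)) +
        (min (μ.rowLen i) (ν.rowLen i) - κ.rowLen i) := by
  rw [isHorizontalStrip_iff_rowLen] at hμ hν
  have key := rowLen_ofRows (f := localRuleRow κ μ ν k) (N := μ.colLen 0 + ν.colLen 0 + 1) ?_ ?_
  · exact ⟨key 0, fun i => key (i + 1)⟩
  · refine antitone_nat_of_succ_le fun i => ?_
    have h1 := hμ i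
    have h2 := hν i
    cases i with
    | zero => simp only [localRuleRow]; omega
    | succ i => simp only [localRuleRow]; omega
  · have h1 : μ.rowLen (μ.colLen 0 + ν.colLen 0) = 0 := rowLen_eq_zero_iff.2 (by omega)
    have h2 : μ.rowLen (μ.colLen 0 + ν.colLen 0 + 1) = 0 := rowLen_eq_zero_iff.2 (by omega)
    have h3 : ν.rowLen (μ.colLen 0 + ν.colLen 0 + 1) = 0 := rowLen_eq_zero_iff.2 (by omega)
    simp only [localRuleRow]
    omega

theorem rowLen_localRuleInv (hμ : IsHorizontalStrip μ ρ) (hν : IsHorizontalStrip ν ρ) (i : ℕ) :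
    (localRuleInv μ ν ρ).rowLen i = max (μ.rowLen (i + 1)) (ν.rowLen (i + 1)) +
      (min (μ.rowLen i) (ν.rowLen i) - ρ.rowLen (i + 1)) := by
  rw [isHorizontalStrip_iff_rowLen] at hμ hν
  refine rowLen_ofRows (f := fun i => max (μ.rowLen (i + 1)) (ν.rowLen (i + 1)) +
    (min (μ.rowLen i) (ν.rowLen i) - ρ.rowLen (i + 1))) ?_ ?_ i
  · refine antitone_nat_of_succ_le fun i => ?_
    have h1 := hμ i
    have h2 := hν i
    have h3 := hμ (i + 1)
    have h4 := hν (i + 1)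
    have h5 := hμ (i + 1 + 1)
    have h6 := hν (i + 1 + 1)
    omega
  · have h1 : μ.rowLen (μ.colLen 0) = 0 := rowLen_eq_zero_iff.2 (by omega)
    have h2 : μ.rowLen (μ.colLen 0 + 1) = 0 := rowLen_eq_zero_iff.2 (by omega)
    -- `ν` may be taller than `μ`, but only by one row: with `N = μ.colLen 0`, `ν_{N+1} ≤ ρ_{N+1} ≤
    -- μ_N = 0`.
    have h3 := hμ (μ.colLen 0)
    have h4 := hν (μ.colLen 0 + 1)
    omega

theorem isHorizontalStrip_localRule_left (hμ : IsHorizontalStrip κ μ)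
    (hν : IsHorizontalStrip κ ν) : IsHorizontalStrip μ (localRule κ μ ν k) := by
  obtain ⟨h0, h1⟩ := rowLen_localRule (k := k) hμ hν
  rw [isHorizontalStrip_iff_rowLen] at hμ hν ⊢
  intro i
  have := hμ i
  have := hν i
  refine ⟨?_, by rw [h1]; omega⟩
  cases i with
  | zero => omega
  | succ i => rw [h1]; omega

theorem isHorizontalStrip_localRule_right (hμ : IsHorizontalStrip κ μ)
    (hν : IsHorizontalStrip κ ν) : IsHorizontalStrip ν (localRule κ μ ν k) := by
  obtain ⟨h0, h1⟩ := rowLen_localRule (k := k) hμ hν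
  rw [isHorizontalStrip_iff_rowLen] at hμ hν ⊢
  intro i
  have := hμ i
  have := hν i
  refine ⟨?_, by rw [h1]; omega⟩
  cases i with
  | zero => omega
  | succ i => rw [h1]; omega

theorem isHorizontalStrip_localRuleInv_left (hμ : IsHorizontalStrip μ ρ)
    (hν : IsHorizontalStrip ν ρ) : IsHorizontalStrip (localRuleInv μ ν ρ) μ := by
  have h1 := rowLen_localRuleInv hμ hν
  rw [isHorizontalStrip_iff_rowLen] at hμ hν ⊢
  intro i
  have := hμ i
  have := hν i
  have := hμ (i + 1)
  have := hν (i + 1)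
  rw [h1]
  omega

theorem isHorizontalStrip_localRuleInv_right (hμ : IsHorizontalStrip μ ρ)
    (hν : IsHorizontalStrip ν ρ) : IsHorizontalStrip (localRuleInv μ ν ρ) ν := by
  have h1 := rowLen_localRuleInv hμ hν
  rw [isHorizontalStrip_iff_rowLen] at hμ hν ⊢
  intro i
  have := hμ i
  have := hν i
  have := hμ (i + 1)
  have := hν (i + 1)
  rw [h1]
  omega

/-- For fixed `μ`, `ν`, row `i` of `κ` and row `i + 1` of `ρ` have the constant sum `max (μ_{i+1})
(ν_{i+1}) + min (μ_i) (ν_i)`, so each determines the other. Interlacing prevents the natural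
subtractions from truncating. Row `0` of `ρ` is left to carry `k`. -/
theorem localRuleInv_localRule (hμ : IsHorizontalStrip κ μ) (hν : IsHorizontalStrip κ ν) :
    localRuleInv μ ν (localRule κ μ ν k) = κ := by
  refine ext_rowLen fun i => ?_
  rw [rowLen_localRuleInv (isHorizontalStrip_localRule_left hμ hν)
    (isHorizontalStrip_localRule_right hμ hν), (rowLen_localRule hμ hν).2]
  rw [isHorizontalStrip_iff_rowLen] at hμ hν
  have := hμ i
  have := hν i
  omega

theorem localRule_localRuleInv (hμ : IsHorizontalStrip μ ρ) (hν : IsHorizontalStrip ν ρ) :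
    localRule (localRuleInv μ ν ρ) μ ν (ρ.rowLen 0 - max (μ.rowLen 0) (ν.rowLen 0)) = ρ := by
  refine ext_rowLen fun i => ?_
  obtain ⟨h0, h1⟩ := rowLen_localRule (k := ρ.rowLen 0 - max (μ.rowLen 0) (ν.rowLen 0))
    (isHorizontalStrip_localRuleInv_left hμ hν) (isHorizontalStrip_localRuleInv_right hμ hν)
  have h2 := rowLen_localRuleInv hμ hν
  rw [isHorizontalStrip_iff_rowLen] at hμ hν
  cases i with
  | zero =>
    have := hμ 0
    have := hν 0
    omega
  | succ i =>
    have := hμ i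
    have := hν i
    have := hμ (i + 1)
    have := hν (i + 1)
    rw [h1, h2]
    omega

/-- Sum the row identities over all rows: the shifted maxima together with row `0` give all maxima,
and `max + min` is the sum of the two entries. -/
theorem card_localRule (hμ : IsHorizontalStrip κ μ) (hν : IsHorizontalStrip κ ν) :
    (localRule κ μ ν k).card + κ.card = μ.card + ν.card + k := by
  obtain ⟨h0, h1⟩ := rowLen_localRule (k := k) hμ hν
  set ρ := localRule κ μ ν k
  set N := ρ.colLen 0 + κ.colLen 0 + μ.colLen 0 + ν.colLen 0
  rw [ρ.card_eq_sum_rowLen (N := N + 1) (by omega), κ.card_eq_sum_rowLen (N := N) (by omega),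
    μ.card_eq_sum_rowLen (N := N + 1) (by omega), ν.card_eq_sum_rowLen (N := N + 1) (by omega),
    Finset.sum_range_succ', h0]
  have key : ∑ i ∈ Finset.range N, ρ.rowLen (i + 1) + ∑ i ∈ Finset.range N, κ.rowLen i =
      ∑ i ∈ Finset.range N, (max (μ.rowLen (i + 1)) (ν.rowLen (i + 1)) +
        min (μ.rowLen i) (ν.rowLen i)) := by
    rw [← Finset.sum_add_distrib]
    refine Finset.sum_congr rfl fun i _ => ?_
    rw [isHorizontalStrip_iff_rowLen] at hμ hν
    have := hμ i
    have := hν i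
    rw [h1]
    omega
  have h2 : ∑ i ∈ Finset.range N, max (μ.rowLen (i + 1)) (ν.rowLen (i + 1)) +
      max (μ.rowLen 0) (ν.rowLen 0) =
      ∑ i ∈ Finset.range N, max (μ.rowLen i) (ν.rowLen i) := by
    rw [← Finset.sum_range_succ' (fun i => max (μ.rowLen i) (ν.rowLen i)), Finset.sum_range_succ,
      rowLen_eq_zero_iff.2 (by omega : μ.colLen 0 ≤ N),
      rowLen_eq_zero_iff.2 (by omega : ν.colLen 0 ≤ N)]
    simp
  have h3 : ∑ i ∈ Finset.range N, max (μ.rowLen i) (ν.rowLen i) +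
      ∑ i ∈ Finset.range N, min (μ.rowLen i) (ν.rowLen i) =
      ∑ i ∈ Finset.range N, μ.rowLen i + ∑ i ∈ Finset.range N, ν.rowLen i := by
    rw [← Finset.sum_add_distrib, ← Finset.sum_add_distrib]
    exact Finset.sum_congr rfl fun i _ => max_add_min _ _
  rw [Finset.sum_add_distrib] at key
  rw [Finset.sum_range_succ, Finset.sum_range_succ,
    rowLen_eq_zero_iff.2 (by omega : μ.colLen 0 ≤ N),
    rowLen_eq_zero_iff.2 (by omega : ν.colLen 0 ≤ N)]
  omega

theorem IsHorizontalStrip.eq_bot (h : IsHorizontalStrip μ ⊥) : μ = ⊥ :=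
  le_bot_iff.1 h.1

end LocalRule

theorem isHorizontalStrip_bot_bot : IsHorizontalStrip ⊥ ⊥ := ⟨le_rfl, by simp⟩

end YoungDiagram

namespace YoungDiagram

/-! ### Chains of horizontal strips -/

theorem finite_setOf_isHorizontalStrip (l : ℕ) (μ : YoungDiagram) :
    {ν : YoungDiagram | IsHorizontalStrip μ ν ∧ ν.rowLen 0 ≤ l}.Finite := by
  refine Set.Finite.of_finite_image (f := cells) ?_ fun ν _ ρ _ h => YoungDiagram.ext h
  refine ((Finset.range (μ.colLen 0 + 1) ×ˢ Finset.range l).powerset.finite_toSet).subset ?_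
  rintro _ ⟨ν, ⟨h1, h2⟩, rfl⟩
  rw [Finset.mem_coe, Finset.mem_powerset]
  rintro ⟨i, j⟩ hij
  have hi := mem_iff_lt_colLen.1 (ν.up_left_mem le_rfl (Nat.zero_le j) hij)
  have hj := mem_iff_lt_rowLen.1 (ν.up_left_mem (Nat.zero_le i) le_rfl hij)
  have := (isHorizontalStrip_iff_colLen.1 h1 0).2
  simp only [Finset.mem_product, Finset.mem_range]
  omega

/-- The diagrams with at most `l` columns obtained from `μ` by adding a horizontal strip. -/
noncomputable def addStrips (l : ℕ) (μ : YoungDiagram) : Finset YoungDiagram :=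
  (finite_setOf_isHorizontalStrip l μ).toFinset

@[simp] theorem mem_addStrips {l : ℕ} {μ ν : YoungDiagram} :
    ν ∈ addStrips l μ ↔ IsHorizontalStrip μ ν ∧ ν.rowLen 0 ≤ l := by
  simp [addStrips]

open Classical in
/-- The sequences `∅ = p 0, p 1, …, p n = p (n + 1) = …` of Young diagrams with at most `l` columns
such that `p (i + 1) / p i` is a horizontal strip for all `i`. These are the semistandard tableaux
with entries in `{1, …, n}` and at most `l` columns. -/
noncomputable def stripChains (l : ℕ) : ℕ → Finset (ℕ → YoungDiagram)
  | 0 => {fun _ => ⊥}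
  | n + 1 => ((stripChains l n).sigma fun p => addStrips l (p n)).image
      fun c i => if i ≤ n then c.1 i else c.2

theorem mem_stripChains {l n : ℕ} {p : ℕ → YoungDiagram} :
    p ∈ stripChains l n ↔ p 0 = ⊥ ∧ (∀ i < n, IsHorizontalStrip (p i) (p (i + 1))) ∧
      (p n).rowLen 0 ≤ l ∧ ∀ i, n ≤ i → p i = p n := by
  induction n generalizing p with
  | zero =>
    simp only [stripChains, Finset.mem_singleton]
    constructor
    · rintro rfl
      simp
    · rintro ⟨h0, -, -, h⟩
      exact funext fun i => (h i (Nat.zero_le i)).trans h0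
  | succ n ih =>
    simp only [stripChains, Finset.mem_image, Finset.mem_sigma, mem_addStrips]
    constructor
    · rintro ⟨⟨p, ν⟩, ⟨hp, h1, h2⟩, rfl⟩
      obtain ⟨h3, h4, -, -⟩ := ih.1 hp
      refine ⟨by simpa using h3, fun i hi => ?_, by simpa using h2, fun i hi => ?_⟩
      · rcases Nat.lt_succ_iff_lt_or_eq.1 hi with hi | rfl
        · simpa [hi.le, Nat.succ_le_iff.2 hi] using h4 i hi
        · simpa using h1
      · simp [show ¬ i ≤ n by omega]
    -- Truncation by `min i n` freezes the chain after `n`, as membership in `stripChains l n`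
    -- demands.
    · rintro ⟨h0, h1, h2, h3⟩
      refine ⟨⟨fun i => p (min i n), p (n + 1)⟩, ⟨ih.2 ⟨by simpa using h0, fun i hi => ?_, ?_,
        fun i hi => ?_⟩, ?_, h2⟩, ?_⟩
      · simpa [hi.le, Nat.succ_le_iff.2 hi] using h1 i (by omega)
      · simpa using ((isHorizontalStrip_iff_rowLen.1 (h1 n (by omega))) 0).1.trans h2
      · simp [hi]
      · simpa using h1 n (by omega)
      · funext i
        by_cases hi : i ≤ n
        · simp [hi]
        · simpa [hi] using (h3 i (by omega)).symm

theorem sum_stripChains_succ {M : Type*} [AddCommMonoid M] (l n : ℕ)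
    (f : (ℕ → YoungDiagram) → M) :
    ∑ p ∈ stripChains l (n + 1), f p = ∑ p ∈ stripChains l n, ∑ ν ∈ addStrips l (p n),
      f fun i => if i ≤ n then p i else ν := by
  classical
  rw [stripChains, Finset.sum_image, Finset.sum_sigma]
  rintro ⟨p, ν⟩ hp ⟨q, ρ⟩ hq h
  simp only [Finset.coe_sigma, Set.mem_sigma_iff, Finset.mem_coe, mem_stripChains] at hp hq
  have hpq : p = q := by
    funext i
    by_cases hi : i ≤ n
    · simpa [hi] using congrFun h i
    · rw [hp.1.2.2.2 i (by omega), hq.1.2.2.2 i (by omega)]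
      simpa using congrFun h n
  subst hpq
  simpa using congrFun h (n + 1)

/-- The weight `∏ i < n, a i ^ |p (i + 1) / p i|` of a chain. -/
def chainWeight {R : Type*} [CommSemiring R] (a : ℕ → R) (n : ℕ) (p : ℕ → YoungDiagram) : R :=
  ∏ i ∈ Finset.range n, a i ^ ((p (i + 1)).card - (p i).card)

/-! ### Growth diagrams -/

/-- The growth diagram of the Robinson-Schensted-Knuth correspondence. -/
def growth (x : ℕ → ℕ → ℕ) : ℕ → ℕ → YoungDiagram
  | 0, _ => ⊥
  | _ + 1, 0 => ⊥
  | i + 1, j + 1 => localRule (growth x i j) (growth x i (j + 1)) (growth x (i + 1) j) (x i j)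
termination_by i j => (i, j)

section Growth

variable (x : ℕ → ℕ → ℕ)

@[simp] theorem growth_zero_left (j : ℕ) : growth x 0 j = ⊥ := by rw [growth]

@[simp] theorem growth_zero_right (i : ℕ) : growth x i 0 = ⊥ := by cases i <;> rw [growth]

theorem growth_succ_succ (i j : ℕ) : growth x (i + 1) (j + 1) =
    localRule (growth x i j) (growth x i (j + 1)) (growth x (i + 1) j) (x i j) := by
  rw [growth]

/-- The local rule needs strips on two sides of a square and yields them on the other two. Hence the
strips along line `i` give those from line `i` to line `i + 1` by induction on `j`, and these give
the strips along line `i + 1`. -/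
theorem isHorizontalStrip_growth (i : ℕ) : ∀ j,
    IsHorizontalStrip (growth x i j) (growth x i (j + 1)) ∧
      IsHorizontalStrip (growth x i j) (growth x (i + 1) j) := by
  have vert : ∀ i, (∀ j, IsHorizontalStrip (growth x i j) (growth x i (j + 1))) →
      ∀ j, IsHorizontalStrip (growth x i j) (growth x (i + 1) j) := by
    intro i h j
    induction j with
    | zero => simpa using isHorizontalStrip_bot_bot
    | succ j ih =>
      rw [growth_succ_succ]
      exact isHorizontalStrip_localRule_left (h j) ih
  have horiz : ∀ j, IsHorizontalStrip (growth x i j) (growth x i (j + 1)) := by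
    induction i with
    | zero => simpa using isHorizontalStrip_bot_bot
    | succ i ih =>
      intro j
      rw [growth_succ_succ]
      exact isHorizontalStrip_localRule_right (ih j) (vert i ih j)
  exact fun j => ⟨horiz j, vert i horiz j⟩

theorem rowLen_zero_growth_succ_succ (i j : ℕ) : (growth x (i + 1) (j + 1)).rowLen 0 =
    max ((growth x i (j + 1)).rowLen 0) ((growth x (i + 1) j).rowLen 0) + x i j := by
  rw [growth_succ_succ]
  exact (rowLen_localRule (isHorizontalStrip_growth x i j).1 (isHorizontalStrip_growth x i j).2).1

/-- Sizes obey the inclusion-exclusion of `card_localRule`, so the increment between neighbouring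
lines telescopes to a partial row sum. -/
theorem card_growth_succ_left (i j : ℕ) : (growth x (i + 1) j).card =
    (growth x i j).card + ∑ j' ∈ Finset.range j, x i j' := by
  induction j with
  | zero => simp
  | succ j ih =>
    have := card_localRule (k := x i j) (isHorizontalStrip_growth x i j).1
      (isHorizontalStrip_growth x i j).2
    rw [← growth_succ_succ] at this
    rw [Finset.sum_range_succ]
    omega

theorem card_growth_succ_right (i j : ℕ) : (growth x i (j + 1)).card =
    (growth x i j).card + ∑ i' ∈ Finset.range i, x i' j := by
  induction i with
  | zero => simp
  | succ i ih =>
    have := card_localRule (k := x i j) (isHorizontalStrip_growth x i j).1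
      (isHorizontalStrip_growth x i j).2
    rw [← growth_succ_succ] at this
    rw [Finset.sum_range_succ]
    omega

theorem rowLen_zero_growth_mono {i i' j j' : ℕ} (hi : i ≤ i') (hj : j ≤ j') :
    (growth x i j).rowLen 0 ≤ (growth x i' j').rowLen 0 := by
  have h1 : Monotone fun i => (growth x i j).rowLen 0 := monotone_nat_of_le_succ fun i =>
    le_iff_rowLen.1 (isHorizontalStrip_growth x i j).2.1 0
  have h2 : Monotone fun j => (growth x i' j).rowLen 0 := monotone_nat_of_le_succ fun j =>
    le_iff_rowLen.1 (isHorizontalStrip_growth x i' j).1.1 0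
  exact (h1 hi).trans (h2 hj)

/-- The growth diagram read backwards: reconstruct the diagrams from their values `p` and `q` on
the outer boundary of the `n × n` square. The indices count the distance from the outer corner. -/
def antigrowth (p q : ℕ → YoungDiagram) (n : ℕ) : ℕ → ℕ → YoungDiagram
  | 0, v => q (n - v)
  | u + 1, 0 => p (n - (u + 1))
  | u + 1, v + 1 => localRuleInv (antigrowth p q n (u + 1) v) (antigrowth p q n u (v + 1))
      (antigrowth p q n u v)
termination_by u v => (u, v)

variable {x}

theorem antigrowth_growth {p q : ℕ → YoungDiagram} {n : ℕ} (hp : ∀ i ≤ n, p i = growth x i n)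
    (hq : ∀ j ≤ n, q j = growth x n j) {u v : ℕ} (hu : u ≤ n) (hv : v ≤ n) :
    antigrowth p q n u v = growth x (n - u) (n - v) := by
  induction u generalizing v with
  | zero => rw [antigrowth, hq _ (by omega), Nat.sub_zero]
  | succ u ihu =>
    induction v with
    | zero => rw [antigrowth, hp _ (by omega), Nat.sub_zero]
    | succ v ihv =>
      rw [antigrowth, ihu (by omega) hv, ihv (by omega), ihu (by omega) (by omega)]
      obtain ⟨i, rfl⟩ : ∃ i, n = i + (u + 1) := ⟨n - (u + 1), by omega⟩
      obtain ⟨j, hj⟩ : ∃ j, i + (u + 1) = j + (v + 1) := ⟨i + (u + 1) - (v + 1), by omega⟩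
      have e1 : i + (u + 1) - (u + 1) = i := by omega
      have e2 : i + (u + 1) - u = i + 1 := by omega
      have e3 : i + (u + 1) - (v + 1) = j := by omega
      have e4 : i + (u + 1) - v = j + 1 := by omega
      rw [e1, e2, e3, e4, growth_succ_succ, localRuleInv_localRule
        (isHorizontalStrip_growth x i j).1 (isHorizontalStrip_growth x i j).2]

section Antigrowth

variable {l n : ℕ} {p q : ℕ → YoungDiagram}

theorem isHorizontalStrip_stripChain (hp : p ∈ stripChains l n) (u : ℕ) :
    IsHorizontalStrip (p (n - (u + 1))) (p (n - u)) := by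
  obtain ⟨h0, h1, -, -⟩ := mem_stripChains.1 hp
  by_cases hu : u < n
  · have := h1 (n - (u + 1)) (by omega)
    rwa [show n - (u + 1) + 1 = n - u by omega] at this
  · rw [show n - (u + 1) = 0 by omega, show n - u = 0 by omega, h0]
    exact isHorizontalStrip_bot_bot

theorem antigrowth_zero_right (hpq : p n = q n) (u : ℕ) : antigrowth p q n u 0 = p (n - u) := by
  cases u with
  | zero => rw [antigrowth, Nat.sub_zero, hpq]
  | succ u => rw [antigrowth]

theorem isHorizontalStrip_antigrowth (hp : p ∈ stripChains l n) (hq : q ∈ stripChains l n)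
    (hpq : p n = q n) (u : ℕ) : ∀ v,
    IsHorizontalStrip (antigrowth p q n u (v + 1)) (antigrowth p q n u v) ∧
      IsHorizontalStrip (antigrowth p q n (u + 1) v) (antigrowth p q n u v) := by
  have vert : ∀ u, (∀ v, IsHorizontalStrip (antigrowth p q n u (v + 1)) (antigrowth p q n u v)) →
      ∀ v, IsHorizontalStrip (antigrowth p q n (u + 1) v) (antigrowth p q n u v) := by
    intro u h v
    induction v with
    | zero =>
      rw [antigrowth_zero_right hpq, antigrowth_zero_right hpq]
      exact isHorizontalStrip_stripChain hp u
    | succ v ih =>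
      rw [antigrowth]
      exact isHorizontalStrip_localRuleInv_right ih (h v)
  have horiz : ∀ v, IsHorizontalStrip (antigrowth p q n u (v + 1)) (antigrowth p q n u v) := by
    induction u with
    | zero =>
      intro v
      rw [antigrowth, antigrowth]
      exact isHorizontalStrip_stripChain hq v
    | succ u ih =>
      intro v
      rw [antigrowth]
      exact isHorizontalStrip_localRuleInv_left (vert u ih v) (ih v)
  exact fun v => ⟨horiz v, vert u horiz v⟩

/-- The corner of this side is `p 0 = ⊥`, and moving inwards only shrinks diagrams. The backward
construction therefore has the empty boundary from which `growth` starts. -/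
theorem antigrowth_left_eq_bot (hp : p ∈ stripChains l n) (hq : q ∈ stripChains l n)
    (hpq : p n = q n) (v : ℕ) : antigrowth p q n n v = ⊥ := by
  induction v with
  | zero => rw [antigrowth_zero_right hpq, Nat.sub_self, (mem_stripChains.1 hp).1]
  | succ v ih =>
    have := (isHorizontalStrip_antigrowth hp hq hpq n v).1
    rw [ih] at this
    exact this.eq_bot

theorem antigrowth_right_eq_bot (hp : p ∈ stripChains l n) (hq : q ∈ stripChains l n)
    (hpq : p n = q n) (u : ℕ) : antigrowth p q n u n = ⊥ := by
  induction u with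
  | zero => rw [antigrowth, Nat.sub_self, (mem_stripChains.1 hq).1]
  | succ u ih =>
    have := (isHorizontalStrip_antigrowth hp hq hpq u n).2
    rw [ih] at this
    exact this.eq_bot

/-- The matrix entries reconstructed from the boundary of a growth diagram. -/
def antigrowthEntry (p q : ℕ → YoungDiagram) (n i j : ℕ) : ℕ :=
  (antigrowth p q n (n - (i + 1)) (n - (j + 1))).rowLen 0 -
    max ((antigrowth p q n (n - i) (n - (j + 1))).rowLen 0)
      ((antigrowth p q n (n - (i + 1)) (n - j)).rowLen 0)

/-- Surjectivity of the correspondence: the forward rule undoes the inverse rule square by square,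
once the empty boundaries agree. -/
theorem growth_antigrowthEntry (hp : p ∈ stripChains l n) (hq : q ∈ stripChains l n)
    (hpq : p n = q n) (hx : ∀ i < n, ∀ j < n, x i j = antigrowthEntry p q n i j)
    {i j : ℕ} (hi : i ≤ n) (hj : j ≤ n) :
    growth x i j = antigrowth p q n (n - i) (n - j) := by
  induction i generalizing j with
  | zero => rw [growth_zero_left, Nat.sub_zero, antigrowth_left_eq_bot hp hq hpq]
  | succ i ihi =>
    induction j with
    | zero => rw [growth_zero_right, Nat.sub_zero, antigrowth_right_eq_bot hp hq hpq]
    | succ j ihj =>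
      rw [growth_succ_succ, ihi (by omega) hj, ihj (by omega), ihi (by omega) (by omega),
        hx i (by omega) j (by omega), antigrowthEntry]
      obtain ⟨u, hu⟩ : ∃ u, n = i + (u + 1) := ⟨n - (i + 1), by omega⟩
      obtain ⟨v, hv⟩ : ∃ v, n = j + (v + 1) := ⟨n - (j + 1), by omega⟩
      rw [show n - i = u + 1 by omega, show n - (i + 1) = u by omega, show n - j = v + 1 by omega,
        show n - (j + 1) = v by omega]
      conv_lhs => rw [antigrowth]
      exact localRule_localRuleInv (isHorizontalStrip_antigrowth hp hq hpq u v).2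
        (isHorizontalStrip_antigrowth hp hq hpq u v).1

theorem antigrowthEntry_growth (hp : ∀ i ≤ n, p i = growth x i n)
    (hq : ∀ j ≤ n, q j = growth x n j) {i j : ℕ} (hi : i < n) (hj : j < n) :
    antigrowthEntry p q n i j = x i j := by
  rw [antigrowthEntry, antigrowth_growth hp hq (by omega) (by omega),
    antigrowth_growth hp hq (by omega) (by omega), antigrowth_growth hp hq (by omega) (by omega),
    show n - (n - (i + 1)) = i + 1 by omega, show n - (n - (j + 1)) = j + 1 by omega,
    show n - (n - i) = i by omega, show n - (n - j) = j by omega, rowLen_zero_growth_succ_succ]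
  omega

end Antigrowth

end Growth

/-! ### The Cauchy identity by the Robinson-Schensted-Knuth bijection -/

/-- The extension by zero of a matrix to all pairs of natural numbers. -/
def extendMatrix {n : ℕ} (x : Fin n → Fin n → ℕ) (i j : ℕ) : ℕ :=
  if h : i < n ∧ j < n then x ⟨i, h.1⟩ ⟨j, h.2⟩ else 0

@[simp] theorem extendMatrix_val {n : ℕ} (x : Fin n → Fin n → ℕ) (i j : Fin n) :
    extendMatrix x i j = x i j := by
  simp [extendMatrix]

open Classical in
/-- The Cauchy identity for diagrams with at most `l` columns. -/
theorem sum_growth_eq_sum_stripChains {R : Type*} [CommRing R] (a b : ℕ → R) (l n : ℕ)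
    (S : Finset (Fin n → Fin n → ℕ))
    (hS : ∀ x, x ∈ S ↔ (growth (extendMatrix x) n n).rowLen 0 ≤ l) :
    ∑ x ∈ S, ∏ i : Fin n, ∏ j : Fin n, (a i * b j) ^ x i j =
      ∑ p ∈ stripChains l n, ∑ q ∈ stripChains l n,
        if p n = q n then chainWeight a n p * chainWeight b n q else 0 := by
  rw [← Finset.sum_product', ← Finset.sum_filter]
  -- A matrix goes to the two outer sides of its growth diagram, frozen beyond `n`; the sides share
  -- the corner `growth n n`.
  refine Finset.sum_nbij'
    (fun x => (fun i => growth (extendMatrix x) (min i n) n,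
      fun j => growth (extendMatrix x) n (min j n)))
    (fun c i j => antigrowthEntry c.1 c.2 n i j) ?_ ?_ ?_ ?_ ?_
  · intro x hx
    rw [hS] at hx
    simp only [Finset.mem_filter, Finset.mem_product, mem_stripChains]
    refine ⟨⟨⟨by simp, fun i hi => ?_, by simpa using hx, fun i hi => by simp [hi]⟩,
      ⟨by simp, fun i hi => ?_, by simpa using hx, fun i hi => by simp [hi]⟩⟩, by simp⟩
    · rw [min_eq_left hi.le, min_eq_left (Nat.succ_le_iff.2 hi)]
      exact (isHorizontalStrip_growth _ i n).2
    · rw [min_eq_left hi.le, min_eq_left (Nat.succ_le_iff.2 hi)]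
      exact (isHorizontalStrip_growth _ n i).1
  · rintro ⟨p, q⟩ hc
    simp only [Finset.mem_filter, Finset.mem_product] at hc
    obtain ⟨⟨hp, hq⟩, hpq⟩ := hc
    rw [hS, growth_antigrowthEntry hp hq hpq (fun i hi j hj => by simp [extendMatrix, hi, hj])
      le_rfl le_rfl, Nat.sub_self, antigrowth_zero_right hpq, Nat.sub_zero]
    exact (mem_stripChains.1 hp).2.2.1
  · intro x _
    funext i j
    rw [antigrowthEntry_growth (x := extendMatrix x) (fun i hi => by simp [hi])
      (fun j hj => by simp [hj]) i.2 j.2, extendMatrix_val]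
  · rintro ⟨p, q⟩ hc
    simp only [Finset.mem_filter, Finset.mem_product] at hc
    obtain ⟨⟨hp, hq⟩, hpq⟩ := hc
    have key := fun {i j : ℕ} (hi : i ≤ n) (hj : j ≤ n) => growth_antigrowthEntry (x := extendMatrix
      fun i j : Fin n => antigrowthEntry p q n i j) hp hq hpq
      (fun i hi j hj => by simp [extendMatrix, hi, hj]) hi hj
    refine Prod.ext (funext fun i => ?_) (funext fun j => ?_)
    · simp only
      rw [key (min_le_right _ _) le_rfl, Nat.sub_self, antigrowth_zero_right hpq]
      rcases le_total i n with hi | hi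
      · rw [min_eq_left hi, Nat.sub_sub_self hi]
      · rw [min_eq_right hi, Nat.sub_self, Nat.sub_zero, (mem_stripChains.1 hp).2.2.2 i hi]
    · simp only
      rw [key le_rfl (min_le_right _ _), Nat.sub_self, antigrowth]
      rcases le_total j n with hj | hj
      · rw [min_eq_left hj, Nat.sub_sub_self hj]
      · rw [min_eq_right hj, Nat.sub_self, Nat.sub_zero, (mem_stripChains.1 hq).2.2.2 j hj]
  · intro x _
    -- The size increments are the row sums of `x` along the first chain and the column sums along
    -- the second.
    have h1 : chainWeight a n (fun i => growth (extendMatrix x) (min i n) n) =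
        ∏ i : Fin n, ∏ j : Fin n, a i ^ x i j := by
      rw [chainWeight, Finset.prod_range]
      refine Finset.prod_congr rfl fun i _ => ?_
      rw [min_eq_left i.2.le, min_eq_left (Nat.succ_le_iff.2 i.2), card_growth_succ_left,
        Nat.add_sub_cancel_left, Finset.sum_range, Finset.prod_pow_eq_pow_sum]
      simp
    have h2 : chainWeight b n (fun j => growth (extendMatrix x) n (min j n)) =
        ∏ j : Fin n, ∏ i : Fin n, b j ^ x i j := by
      rw [chainWeight, Finset.prod_range]
      refine Finset.prod_congr rfl fun i _ => ?_
      rw [min_eq_left i.2.le, min_eq_left (Nat.succ_le_iff.2 i.2), card_growth_succ_right,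
        Nat.add_sub_cancel_left, Finset.sum_range, Finset.prod_pow_eq_pow_sum]
      simp
    rw [h1, h2, Finset.prod_comm (f := fun j i : Fin n => b j ^ x i j), ← Finset.prod_mul_distrib]
    refine Finset.prod_congr rfl fun i _ => ?_
    rw [← Finset.prod_mul_distrib]
    exact Finset.prod_congr rfl fun j _ => mul_pow _ _ _

end YoungDiagram

/-! ### Last passage time as the first row of the growth diagram -/

namespace JohanssonModel

open YoungDiagram

variable {n : ℕ}

theorem sum_le_rowLen_growth (x : Fin n → Fin n → ℕ) (p : List (Fin n × Fin n)) :
    ∀ q : Fin n × Fin n, p.getLast? = some q → p.IsChain Step →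
      (p.map fun q => x q.1 q.2).sum ≤
        (growth (extendMatrix x) (q.1 + 1) (q.2 + 1)).rowLen 0 := by
  induction p using List.reverseRecOn with
  | nil => simp
  | append_singleton p r ih =>
    intro q hq hchain
    obtain rfl : r = q := by simpa using hq
    rw [List.isChain_append] at hchain
    obtain ⟨hp, -, hs⟩ := hchain
    rw [rowLen_zero_growth_succ_succ, extendMatrix_val, List.map_append, List.sum_append]
    simp only [List.map_cons, List.map_nil, List.sum_cons, List.sum_nil, add_zero,
      add_le_add_iff_right]
    rcases hlast : p.getLast? with - | s
    · rw [List.getLast?_eq_none_iff] at hlast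
      simp [hlast]
    · refine (ih s hlast hp).trans ?_
      rcases hs s (by simp [hlast]) r (by simp) with ⟨h1, h2⟩ | ⟨h1, h2⟩
      · rw [h1, h2]
        exact le_max_left _ _
      · rw [h1, h2]
        exact le_max_right _ _

theorem exists_sum_eq_rowLen_growth [NeZero n] (x : Fin n → Fin n → ℕ) : ∀ (m : ℕ) (q : Fin n × Fin n),
    (q.1 : ℕ) + q.2 = m →
    ∃ p : List (Fin n × Fin n), p.head? = some (0, 0) ∧ p.getLast? = some q ∧ p.IsChain Step ∧
      (growth (extendMatrix x) (q.1 + 1) (q.2 + 1)).rowLen 0 =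
        (p.map fun q => x q.1 q.2).sum := by
  intro m
  induction m with
  | zero =>
    intro q hq
    obtain rfl : q = (0, 0) := by
      ext
      · simpa using (by omega : (q.1 : ℕ) = 0)
      · simpa using (by omega : (q.2 : ℕ) = 0)
    refine ⟨[(0, 0)], rfl, rfl, by simp, ?_⟩
    rw [rowLen_zero_growth_succ_succ, extendMatrix_val]
    simp
  | succ m ih =>
    intro q hq
    have : ∃ r : Fin n × Fin n, (r.1 : ℕ) + r.2 = m ∧ Step r q ∧
        max ((growth (extendMatrix x) q.1 (q.2 + 1)).rowLen 0)
          ((growth (extendMatrix x) (q.1 + 1) q.2).rowLen 0) =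
          (growth (extendMatrix x) (r.1 + 1) (r.2 + 1)).rowLen 0 := by
      have hleft : (growth (extendMatrix x) (q.1 + 1) q.2).rowLen 0 ≤
          (growth (extendMatrix x) q.1 (q.2 + 1)).rowLen 0 → (q.1 : ℕ) ≠ 0 →
          ∃ r : Fin n × Fin n, (r.1 : ℕ) + r.2 = m ∧ Step r q ∧
          max ((growth (extendMatrix x) q.1 (q.2 + 1)).rowLen 0)
            ((growth (extendMatrix x) (q.1 + 1) q.2).rowLen 0) =
            (growth (extendMatrix x) (r.1 + 1) (r.2 + 1)).rowLen 0 := fun hle h0 => by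
        refine ⟨(⟨q.1 - 1, by omega⟩, q.2), by simp; omega, Or.inl ⟨by simp; omega, rfl⟩, ?_⟩
        rw [max_eq_left hle]
        simp only
        rw [show (q.1 : ℕ) - 1 + 1 = q.1 by omega]
      have hright : (growth (extendMatrix x) q.1 (q.2 + 1)).rowLen 0 ≤
          (growth (extendMatrix x) (q.1 + 1) q.2).rowLen 0 → (q.2 : ℕ) ≠ 0 →
          ∃ r : Fin n × Fin n, (r.1 : ℕ) + r.2 = m ∧ Step r q ∧
          max ((growth (extendMatrix x) q.1 (q.2 + 1)).rowLen 0)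
            ((growth (extendMatrix x) (q.1 + 1) q.2).rowLen 0) =
            (growth (extendMatrix x) (r.1 + 1) (r.2 + 1)).rowLen 0 := fun hle h0 => by
        refine ⟨(q.1, ⟨q.2 - 1, by omega⟩), by simp; omega, Or.inr ⟨rfl, by simp; omega⟩, ?_⟩
        rw [max_eq_right hle]
        simp only
        rw [show (q.2 : ℕ) - 1 + 1 = q.2 by omega]
      -- On the lower boundary one of the two neighbouring diagrams is empty, so the maximum is
      -- attained at the other; elsewhere the predecessor with the larger first row is chosen.
      by_cases h1 : (q.1 : ℕ) = 0
      · exact hright (by simp [h1]) (by omega)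
      by_cases h2 : (q.2 : ℕ) = 0
      · exact hleft (by simp [h2]) h1
      rcases le_total ((growth (extendMatrix x) (q.1 + 1) q.2).rowLen 0)
        ((growth (extendMatrix x) q.1 (q.2 + 1)).rowLen 0) with h | h
      · exact hleft h h1
      · exact hright h h2
    obtain ⟨r, hr, hs, hmax⟩ := this
    obtain ⟨p, h1, h2, h3, h4⟩ := ih r hr
    refine ⟨p ++ [q], by simp [h1], by simp, ?_, ?_⟩
    · rw [List.isChain_append]
      refine ⟨h3, by simp, ?_⟩
      intro y hy z hz
      rw [h2] at hy
      simp only [Option.mem_def, Option.some.injEq, List.head?_cons] at hy hz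
      subst hy hz
      exact hs
    · rw [rowLen_zero_growth_succ_succ, hmax, h4, extendMatrix_val]
      simp

theorem lastPassageTime_eq_rowLen_growth [NeZero n] (x : Fin n → Fin n → ℕ) :
    lastPassageTime x = (growth (extendMatrix x) n n).rowLen 0 := by
  have htop : ((⊤ : Fin n) : ℕ) + 1 = n := by
    have h := NeZero.ne n
    have : (⟨n - 1, by omega⟩ : Fin n) ≤ ⊤ := le_top
    rw [Fin.le_def] at this
    have := (⊤ : Fin n).2
    simp only at *
    omega
  refine (isGreatest_lastPassageTime x).unique ⟨?_, ?_⟩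
  · obtain ⟨p, h1, h2, h3, h4⟩ := exists_sum_eq_rowLen_growth x _ (⊤, ⊤) rfl
    refine ⟨p, ⟨h1, h2, h3⟩, ?_⟩
    simpa only [htop] using h4
  · rintro _ ⟨p, ⟨-, h2, h3⟩, rfl⟩
    simpa only [htop] using sum_le_rowLen_growth x p _ h2 h3

end JohanssonModel

/-! ### Alternants -/

/-- The alternant `det (z k ^ s j)`. -/
def alternant {R : Type*} [CommRing R] {l : ℕ} (s : Fin l → ℕ) (z : Fin l → R) : R :=
  (Matrix.of fun j k => z k ^ s j).det

section Alternant

variable {R : Type*} [CommRing R] {l : ℕ}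

theorem alternant_eq_zero {s : Fin l → ℕ} (z : Fin l → R) (hs : ¬ Function.Injective s) :
    alternant s z = 0 := by
  simp only [Function.Injective, not_forall] at hs
  obtain ⟨i, j, hij, hne⟩ := hs
  refine Matrix.det_zero_of_row_eq hne ?_
  funext k
  simp [hij]

theorem alternant_val (z : Fin l → R) :
    alternant (fun j : Fin l => (j : ℕ)) z = ∏ j, ∏ k ∈ Finset.Ioi j, (z k - z j) := by
  rw [← Matrix.det_vandermonde, ← Matrix.det_transpose, alternant]
  rfl

/-- Scaling column `k` by `1 + b * z k` turns row `j` into the sum of the rows with exponents `s j`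
and `s j + 1`, the latter weighted by `b`; the determinant is then expanded multilinearly in its
rows. -/
theorem prod_one_add_mul_alternant (b : R) (s : Fin l → ℕ) (z : Fin l → R) :
    (∏ k, (1 + b * z k)) * alternant s z =
      ∑ e : Fin l → Fin 2, b ^ (∑ j, (e j : ℕ)) * alternant (fun j => s j + e j) z := by
  rw [alternant, ← Matrix.det_mul_row]
  have h : (Matrix.of fun i j => (1 + b * z j) * Matrix.of (fun j k => z k ^ s j) i j) =
      fun j => ∑ e : Fin 2, b ^ (e : ℕ) • fun k => z k ^ (s j + e) := by
    funext j k
    simp [Fin.sum_univ_two]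
    ring
  rw [h]
  have := (Matrix.detRowAlternating (R := R) (n := Fin l)).toMultilinearMap.map_sum
    (fun j (e : Fin 2) => b ^ (e : ℕ) • fun k => z k ^ (s j + e))
  refine this.trans (Finset.sum_congr rfl fun e _ => ?_)
  rw [MultilinearMap.map_smul_univ, Finset.prod_pow_eq_pow_sum]
  rfl

end Alternant

/-! ### The Pieri rule and the expansion of the product over chains -/

namespace YoungDiagram

/-- The strictly increasing exponents `μ'_{l - j} + j` attached to a diagram `μ` with at most `l`
columns, where `μ'` is the conjugate partition. -/
def columnExponents (l : ℕ) (μ : YoungDiagram) (j : Fin l) : ℕ := μ.colLen j.rev + j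

variable {l : ℕ}

theorem strictMono_columnExponents (μ : YoungDiagram) : StrictMono (columnExponents l μ) := by
  intro i j hij
  have := μ.colLen_anti j.rev i.rev (by simp only [Fin.val_rev]; omega)
  rw [Fin.lt_def] at hij
  simp only [columnExponents]
  omega

theorem columnExponents_bot : columnExponents l ⊥ = fun j : Fin l => (j : ℕ) := by
  funext j
  simp [columnExponents]

theorem columnExponents_injOn {μ ν : YoungDiagram} (hμ : μ.rowLen 0 ≤ l) (hν : ν.rowLen 0 ≤ l)
    (h : columnExponents l μ = columnExponents l ν) : μ = ν := by
  refine ext_colLen fun j => ?_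
  by_cases hj : j < l
  · have := congrFun h (Fin.rev ⟨j, hj⟩)
    simpa [columnExponents] using this
  · rw [colLen_eq_zero_iff.2 (by omega), colLen_eq_zero_iff.2 (by omega)]

theorem card_eq_sum_colLen_rev {μ : YoungDiagram} (hμ : μ.rowLen 0 ≤ l) :
    μ.card = ∑ j : Fin l, μ.colLen j.rev := by
  rw [card_eq_sum_colLen μ hμ, Finset.sum_range]
  exact (Equiv.sum_comp Fin.revPerm fun j : Fin l => μ.colLen j).symm

variable {R : Type*} [CommRing R]

/-- The Pieri rule for alternants. -/
theorem prod_one_add_mul_alternant_columnExponents (b : R) (z : Fin l → R) {μ : YoungDiagram}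
    (hμ : μ.rowLen 0 ≤ l) :
    (∏ k, (1 + b * z k)) * alternant (columnExponents l μ) z =
      ∑ ν ∈ addStrips l μ, b ^ (ν.card - μ.card) * alternant (columnExponents l ν) z := by
  rw [prod_one_add_mul_alternant]
  symm
  have hle : ∀ ν ∈ addStrips l μ, ∀ j : Fin l, μ.colLen j.rev ≤ ν.colLen j.rev ∧
      ν.colLen j.rev ≤ μ.colLen j.rev + 1 := fun ν hν j =>
    isHorizontalStrip_iff_colLen.1 (mem_addStrips.1 hν).1 _
  have hexp : ∀ ν (hν : ν ∈ addStrips l μ), columnExponents l ν = fun j =>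
      columnExponents l μ j + (Fin.ofNat 2 (ν.colLen j.rev - μ.colLen j.rev) : ℕ) := by
    intro ν hν
    funext j
    have := hle ν hν j
    simp only [columnExponents, Fin.ofNat]
    omega
  -- A strip is encoded by which columns it lengthens; the differences are at most one, so
  -- `Fin.ofNat 2` loses nothing. A 0-1 vector not of this form has two equal exponents, and its
  -- alternant vanishes.
  refine Finset.sum_of_injOn (fun ν j => Fin.ofNat 2 (ν.colLen j.rev - μ.colLen j.rev)) ?_ ?_ ?_ ?_
  · intro ν hν ρ hρ h
    refine columnExponents_injOn (mem_addStrips.1 hν).2 (mem_addStrips.1 hρ).2 ?_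
    rw [hexp ν hν, hexp ρ hρ]
    funext j
    exact congrArg (fun e : Fin 2 => columnExponents l μ j + (e : ℕ)) (congrFun h j)
  · exact fun _ _ => Finset.mem_coe.2 (Finset.mem_univ _)
  · intro e _ he
    rw [alternant_eq_zero, mul_zero]
    intro hinj
    apply he
    have hmono : StrictMono fun j => columnExponents l μ j + (e j : ℕ) := by
      refine Monotone.strictMono_of_injective (fun i j hij => ?_) hinj
      rcases hij.eq_or_lt with rfl | hij
      · exact le_rfl
      · have := strictMono_columnExponents (l := l) μ hij
        have := (e i).2
        omega
    -- The column lengths of the wanted diagram, reversed because `columnExponents` lists columns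
    -- from last to first. Strict increase of the exponents is weak decrease of the columns.
    let f : ℕ → ℕ := fun j => if h : j < l then μ.colLen j + e (Fin.rev ⟨j, h⟩) else 0
    have hf : Antitone f := by
      refine antitone_nat_of_succ_le fun j => ?_
      by_cases h : j + 1 < l
      · have hj : j < l := by omega
        have hlt : Fin.rev ⟨j + 1, h⟩ < Fin.rev (⟨j, hj⟩ : Fin l) := by
          rw [Fin.rev_lt_rev, Fin.lt_def]
          simp
        have := hmono hlt
        simp only [columnExponents, Fin.rev_rev, Fin.val_rev] at this
        simp only [f, h, hj, dif_pos]
        omega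
      · simp [f, h]
    obtain ⟨ν, hν⟩ := exists_colLen_eq hf (N := l) (by simp [f])
    refine ⟨ν, Finset.mem_coe.2 (mem_addStrips.2 ⟨isHorizontalStrip_iff_colLen.2 fun j => ?_, ?_⟩),
      ?_⟩
    · rw [hν]
      by_cases h : j < l
      · have := (e (Fin.rev ⟨j, h⟩)).2
        simp only [f, h, dif_pos]
        omega
      · simp [f, h, colLen_eq_zero_iff.2 (by omega : μ.rowLen 0 ≤ j)]
    · rw [← colLen_eq_zero_iff, hν]
      simp [f]
    · funext j
      have : ν.colLen j.rev = μ.colLen j.rev + e j := by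
        rw [hν]
        simp only [f, Fin.is_lt, dif_pos, Fin.eta, Fin.rev_rev]
      simp only [this, Nat.add_sub_cancel_left]
      exact Fin.ofNat_val_eq_self _
  · intro ν hν
    rw [← hexp ν hν, card_eq_sum_colLen_rev hμ, card_eq_sum_colLen_rev (mem_addStrips.1 hν).2,
      ← Finset.sum_tsub_distrib _ fun j _ => (hle ν hν j).1]
    congr 2
    refine Finset.sum_congr rfl fun j _ => ?_
    have := hle ν hν j
    simp only [Fin.ofNat]
    omega

theorem chainWeight_ite {R : Type*} [CommSemiring R] (a : ℕ → R) (n : ℕ) (p : ℕ → YoungDiagram)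
    (ν : YoungDiagram) :
    chainWeight a (n + 1) (fun i => if i ≤ n then p i else ν) =
      chainWeight a n p * a n ^ (ν.card - (p n).card) := by
  rw [chainWeight, Finset.prod_range_succ, chainWeight]
  congr 1
  · refine Finset.prod_congr rfl fun i hi => ?_
    rw [Finset.mem_range] at hi
    simp [hi.le, Nat.succ_le_iff.2 hi]
  · simp

/-- This is the dual Cauchy identity with denominators cleared: the Vandermonde product is the
alternant of the empty diagram, and each factor `∏ k, (1 + b i * z k)` adds one horizontal strip. -/
theorem prod_mul_vandermonde_eq_sum_stripChains (b : ℕ → R) (z : Fin l → R) (n : ℕ) :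
    (∏ i ∈ Finset.range n, ∏ k, (1 + b i * z k)) * ∏ j, ∏ k ∈ Finset.Ioi j, (z k - z j) =
      ∑ p ∈ stripChains l n, chainWeight b n p * alternant (columnExponents l (p n)) z := by
  induction n with
  | zero => simp [stripChains, chainWeight, columnExponents_bot, alternant_val]
  | succ n ih =>
    rw [Finset.prod_range_succ, mul_right_comm, ih, Finset.sum_mul, sum_stripChains_succ]
    refine Finset.sum_congr rfl fun p hp => ?_
    rw [mul_assoc, mul_comm (alternant _ _), prod_one_add_mul_alternant_columnExponents _ _
      (mem_stripChains.1 hp).2.2.1, Finset.mul_sum]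
    refine Finset.sum_congr rfl fun ν _ => ?_
    rw [chainWeight_ite]
    simp [mul_assoc]

end YoungDiagram

/-! ### Orthogonality of alternants and the unitary average -/

namespace JohanssonModel

open MeasureTheory YoungDiagram

theorem integral_exp_pow_mul_exp_neg_pow (m n : ℕ) :
    ∫ θ in Set.Icc 0 (2 * Real.pi),
      Complex.exp (Complex.I * (θ : ℂ)) ^ m * Complex.exp (-(Complex.I * (θ : ℂ))) ^ n =
      if m = n then (2 * Real.pi : ℂ) else 0 := by
  have hexp : ∀ θ : ℝ, Complex.exp (Complex.I * (θ : ℂ)) ^ m *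
      Complex.exp (-(Complex.I * (θ : ℂ))) ^ n =
      Complex.exp ((((m : ℂ) - n) * Complex.I) * θ) := by
    intro θ
    rw [← Complex.exp_nat_mul, ← Complex.exp_nat_mul, ← Complex.exp_add]
    ring_nf
  simp only [hexp]
  rw [integral_Icc_eq_integral_Ioc, ← intervalIntegral.integral_of_le (by positivity)]
  split_ifs with h
  · subst h
    simp
  · have hc : ((m : ℂ) - n) * Complex.I ≠ 0 :=
      mul_ne_zero (sub_ne_zero.2 (by exact_mod_cast h)) Complex.I_ne_zero
    rw [integral_exp_mul_complex hc]
    have h1 : Complex.exp (((m : ℂ) - n) * Complex.I * ((2 * Real.pi : ℝ) : ℂ)) = 1 := by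
      rw [Complex.exp_eq_one_iff]
      refine ⟨(m : ℤ) - n, ?_⟩
      push_cast
      ring
    rw [h1]
    simp

theorem setIntegral_Icc_fintype_prod {ι : Type*} [Fintype ι] (a b : ι → ℝ) (f : ι → ℝ → ℂ) :
    ∫ θ in Set.Icc a b, ∏ i, f i (θ i) = ∏ i, ∫ t in Set.Icc (a i) (b i), f i t := by
  rw [← Set.pi_univ_Icc, volume_pi, Measure.restrict_pi_pi, integral_fintype_prod_eq_prod]

/-- A strictly increasing sequence is determined by its range, which permutations do not change.
This singles out the surviving terms in the product of two expanded determinants. -/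
theorem eq_and_eq_of_strictMono_comp_perm {l : ℕ} {s t : Fin l → ℕ} (hs : StrictMono s)
    (ht : StrictMono t) {σ τ : Equiv.Perm (Fin l)} (h : ∀ k, s (σ k) = t (τ k)) :
    s = t ∧ σ = τ := by
  have hst : s = t := by
    rw [← hs.range_inj ht]
    rw [← σ.surjective.range_comp s, ← τ.surjective.range_comp t]
    exact congrArg Set.range (funext h)
  refine ⟨hst, Equiv.ext fun k => ht.injective ?_⟩
  rw [← h, hst]

open Classical in
/-- Orthogonality of the alternants, that is, of the characters of the unitary group. -/
theorem integral_alternant_mul_alternant {l : ℕ} {s t : Fin l → ℕ} (hs : StrictMono s)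
    (ht : StrictMono t) :
    ∫ θ in Set.Icc (0 : Fin l → ℝ) (fun _ => 2 * Real.pi),
      alternant t (fun k => Complex.exp (-(Complex.I * (θ k : ℂ)))) *
        alternant s (fun k => Complex.exp (Complex.I * (θ k : ℂ))) =
      if t = s then (2 * Real.pi : ℂ) ^ l * (Nat.factorial l : ℂ) else 0 := by
  have hexpand : ∀ θ : Fin l → ℝ,
      alternant t (fun k => Complex.exp (-(Complex.I * (θ k : ℂ)))) *
        alternant s (fun k => Complex.exp (Complex.I * (θ k : ℂ))) =
      ∑ τ : Equiv.Perm (Fin l), ∑ σ : Equiv.Perm (Fin l),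
        ((Equiv.Perm.sign τ : ℤ) : ℂ) * ((Equiv.Perm.sign σ : ℤ) : ℂ) *
        ∏ k, (Complex.exp (Complex.I * (θ k : ℂ)) ^ s (σ k) *
          Complex.exp (-(Complex.I * (θ k : ℂ))) ^ t (τ k)) := by
    intro θ
    rw [alternant, alternant, Matrix.det_apply', Matrix.det_apply', Finset.sum_mul_sum]
    refine Finset.sum_congr rfl fun τ _ => Finset.sum_congr rfl fun σ _ => ?_
    simp only [Matrix.of_apply]
    rw [Finset.prod_mul_distrib]
    ring
  have hint : ∀ σ τ : Equiv.Perm (Fin l), IntegrableOn (fun θ : Fin l → ℝ =>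
      ((Equiv.Perm.sign τ : ℤ) : ℂ) * ((Equiv.Perm.sign σ : ℤ) : ℂ) *
        ∏ k, (Complex.exp (Complex.I * (θ k : ℂ)) ^ s (σ k) *
          Complex.exp (-(Complex.I * (θ k : ℂ))) ^ t (τ k)))
      (Set.Icc (0 : Fin l → ℝ) (fun _ => 2 * Real.pi)) := fun σ τ =>
    ContinuousOn.integrableOn_compact isCompact_Icc (by fun_prop)
  have hterm : ∀ σ τ : Equiv.Perm (Fin l),
      ∫ θ in Set.Icc (0 : Fin l → ℝ) (fun _ => 2 * Real.pi),
        ((Equiv.Perm.sign τ : ℤ) : ℂ) * ((Equiv.Perm.sign σ : ℤ) : ℂ) *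
        ∏ k, (Complex.exp (Complex.I * (θ k : ℂ)) ^ s (σ k) *
          Complex.exp (-(Complex.I * (θ k : ℂ))) ^ t (τ k)) =
      if t = s ∧ σ = τ then (2 * Real.pi : ℂ) ^ l else 0 := by
    intro σ τ
    rw [integral_const_mul, setIntegral_Icc_fintype_prod (0 : Fin l → ℝ) (fun _ => 2 * Real.pi)
      fun k θ => Complex.exp (Complex.I * (θ : ℂ)) ^ s (σ k) *
        Complex.exp (-(Complex.I * (θ : ℂ))) ^ t (τ k)]
    simp only [Pi.zero_apply, integral_exp_pow_mul_exp_neg_pow]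
    split_ifs with h
    · obtain ⟨rfl, rfl⟩ := h
      rcases Int.units_eq_one_or (Equiv.Perm.sign σ) with h | h <;> simp [h]
    · have : ∃ k, s (σ k) ≠ t (τ k) := by
        by_contra! hall
        obtain ⟨h1, h2⟩ := eq_and_eq_of_strictMono_comp_perm hs ht hall
        exact h ⟨h1.symm, h2⟩
      obtain ⟨k, hk⟩ := this
      rw [Finset.prod_eq_zero (Finset.mem_univ k) (if_neg hk), mul_zero]
  simp only [hexpand]
  rw [integral_finsetSum _ fun τ _ => integrable_finsetSum _ fun σ _ => hint σ τ]
  simp only [integral_finsetSum _ fun σ _ => hint σ _, hterm]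
  -- Only the `l!` diagonal pairs `σ = τ` contribute, each `(2π)^l`.
  split_ifs with h
  · simp [h, Fintype.card_perm, mul_comm]
  · simp [h]

/-- Since `e^{-iθ}` is the conjugate of `e^{iθ}`, each squared modulus splits into a factor in
`e^{-iθ}` and one in `e^{iθ}`. The `a`-product can then absorb one Vandermonde factor and the
`b`-product the other. -/
theorem ofReal_unitaryDensity (l : ℕ) (θ : Fin l → ℝ) :
    (unitaryDensity l θ : ℂ) = ((2 * Real.pi : ℂ) ^ l * (Nat.factorial l : ℂ))⁻¹ *
      ((∏ j : Fin l, ∏ k ∈ Finset.Ioi j,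
        (Complex.exp (-(Complex.I * (θ k : ℂ))) - Complex.exp (-(Complex.I * (θ j : ℂ))))) *
      ∏ j : Fin l, ∏ k ∈ Finset.Ioi j,
        (Complex.exp (Complex.I * (θ k : ℂ)) - Complex.exp (Complex.I * (θ j : ℂ)))) := by
  have hconj : ∀ t : ℝ, Complex.exp (-(Complex.I * (t : ℂ))) =
      (starRingEnd ℂ) (Complex.exp (Complex.I * (t : ℂ))) := by
    intro t
    rw [← Complex.exp_conj]
    simp
  rw [unitaryDensity, ← Finset.prod_mul_distrib]
  simp only [← Finset.prod_mul_distrib, hconj, ← map_sub, Complex.conj_mul']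
  push_cast
  rw [one_div]

open Classical in
theorem unitaryAverage_eq_sum_stripChains (a b : ℕ → ℂ) (n l : ℕ) :
    unitaryAverage l (fun θ => ∏ j : Fin n, ∏ k : Fin l,
      (1 + a j * Complex.exp (-(Complex.I * (θ k : ℂ)))) *
        (1 + b j * Complex.exp (Complex.I * (θ k : ℂ)))) =
      ∑ p ∈ stripChains l n, ∑ q ∈ stripChains l n,
        if p n = q n then chainWeight a n p * chainWeight b n q else 0 := by
  have hexpand : ∀ θ : Fin l → ℝ, (∏ j : Fin n, ∏ k : Fin l,
      (1 + a j * Complex.exp (-(Complex.I * (θ k : ℂ)))) *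
        (1 + b j * Complex.exp (Complex.I * (θ k : ℂ)))) * (unitaryDensity l θ : ℂ) =
      ((2 * Real.pi : ℂ) ^ l * (Nat.factorial l : ℂ))⁻¹ * ∑ p ∈ stripChains l n,
        ∑ q ∈ stripChains l n, chainWeight a n p * chainWeight b n q *
        (alternant (columnExponents l (p n)) (fun k => Complex.exp (-(Complex.I * (θ k : ℂ)))) *
        alternant (columnExponents l (q n)) (fun k => Complex.exp (Complex.I * (θ k : ℂ)))) := by
    intro θ
    have ha := prod_mul_vandermonde_eq_sum_stripChains a
      (fun k => Complex.exp (-(Complex.I * (θ k : ℂ)))) n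
    have hb := prod_mul_vandermonde_eq_sum_stripChains b
      (fun k => Complex.exp (Complex.I * (θ k : ℂ))) n
    rw [Finset.prod_range] at ha hb
    have hprod := congrArg₂ (· * ·) ha hb
    simp only [Finset.sum_mul_sum] at hprod
    rw [ofReal_unitaryDensity]
    simp only [Finset.prod_mul_distrib]
    rw [mul_left_comm]
    congr 1
    rw [mul_mul_mul_comm, hprod]
    exact Finset.sum_congr rfl fun p _ => Finset.sum_congr rfl fun q _ => mul_mul_mul_comm _ _ _ _
  have hint : ∀ p q : ℕ → YoungDiagram, IntegrableOn (fun θ : Fin l → ℝ =>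
      chainWeight a n p * chainWeight b n q *
        (alternant (columnExponents l (p n)) (fun k => Complex.exp (-(Complex.I * (θ k : ℂ)))) *
        alternant (columnExponents l (q n)) (fun k => Complex.exp (Complex.I * (θ k : ℂ)))))
      (Set.Icc (0 : Fin l → ℝ) (fun _ => 2 * Real.pi)) := by
    intro p q
    refine ContinuousOn.integrableOn_compact isCompact_Icc ?_
    simp only [alternant, Matrix.det_apply', Matrix.of_apply]
    fun_prop
  have hne : (2 * Real.pi : ℂ) ^ l * (Nat.factorial l : ℂ) ≠ 0 := by
    refine mul_ne_zero (pow_ne_zero _ (mul_ne_zero two_ne_zero ?_)) ?_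
    · exact_mod_cast Real.pi_ne_zero
    · exact_mod_cast Nat.factorial_ne_zero l
  rw [unitaryAverage]
  simp only [hexpand]
  rw [integral_const_mul, integral_finsetSum _ fun p _ => integrable_finsetSum _
    fun q _ => hint p q]
  simp only [integral_finsetSum _ fun q _ => hint _ q, integral_const_mul,
    integral_alternant_mul_alternant (strictMono_columnExponents _) (strictMono_columnExponents _)]
  rw [Finset.mul_sum]
  refine Finset.sum_congr rfl fun p hp => ?_
  rw [Finset.mul_sum]
  refine Finset.sum_congr rfl fun q hq => ?_
  -- Both final shapes have at most `l` columns, so their exponents determine them.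
  have hiff : columnExponents l (p n) = columnExponents l (q n) ↔ p n = q n :=
    ⟨columnExponents_injOn (mem_stripChains.1 hp).2.2.1 (mem_stripChains.1 hq).2.2.1,
      fun h => by rw [h]⟩
  simp only [hiff]
  split_ifs
  · rw [mul_comm, mul_assoc, mul_inv_cancel₀ hne, mul_one]
  · simp

end JohanssonModel

/-! ### The distribution of the last passage time -/

namespace JohanssonModel

open MeasureTheory YoungDiagram

/-- The matrices whose last passage time is at most `l`. -/
noncomputable def boundedMatrices (n : ℕ) [NeZero n] (l : ℕ) : Finset (Fin n → Fin n → ℕ) :=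
  (Fintype.piFinset fun _ => Fintype.piFinset fun _ => Finset.range (l + 1)).filter
    fun x => lastPassageTime x ≤ l

/-- Every entry is at most the last passage time, because first rows grow along the growth diagram;
the finite box in the definition thus excludes nothing. -/
theorem mem_boundedMatrices {n : ℕ} [NeZero n] {l : ℕ} {x : Fin n → Fin n → ℕ} :
    x ∈ boundedMatrices n l ↔ lastPassageTime x ≤ l := by
  simp only [boundedMatrices, Finset.mem_filter, Fintype.mem_piFinset, Finset.mem_range,
    and_iff_right_iff_imp]
  intro h i j
  rw [lastPassageTime_eq_rowLen_growth] at h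
  have h1 := rowLen_zero_growth_mono (extendMatrix x) (Nat.succ_le_iff.2 i.2)
    (Nat.succ_le_iff.2 j.2)
  rw [rowLen_zero_growth_succ_succ, extendMatrix_val] at h1
  omega

theorem measureReal_lastPassageTime_le {Ω : Type*} [MeasurableSpace Ω]
    (P : Measure Ω) [IsProbabilityMeasure P] (n : ℕ) [NeZero n] (a b : Fin n → ℝ)
    (X : Fin n → Fin n → Ω → ℕ) (hmeas : ∀ i j, Measurable (X i j))
    (hindep : ProbabilityTheory.iIndepFun (fun s : Fin n × Fin n => X s.1 s.2) P)
    (hgeom : ∀ i j k, P.real {ω | X i j ω = k} = (1 - a i * b j) * (a i * b j) ^ k) (l : ℕ) :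
    P.real {ω | lastPassageTime (fun i j => X i j ω) ≤ l} =
      (∏ i, ∏ j, (1 - a i * b j)) *
        ∑ x ∈ boundedMatrices n l, ∏ i, ∏ j, (a i * b j) ^ x i j := by
  have hunion : {ω | lastPassageTime (fun i j => X i j ω) ≤ l} =
      ⋃ x ∈ boundedMatrices n l, ⋂ s : Fin n × Fin n, X s.1 s.2 ⁻¹' {x s.1 s.2} := by
    ext ω
    simp only [Set.mem_ofPred_eq, Set.mem_iUnion, Set.mem_iInter, Set.mem_preimage,
      Set.mem_singleton_iff, exists_prop, mem_boundedMatrices, Prod.forall]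
    constructor
    · exact fun h => ⟨_, h, fun _ _ => rfl⟩
    · rintro ⟨x, hx, h⟩
      rwa [show (fun i j => X i j ω) = x from funext fun i => funext fun j => h i j]
  rw [hunion, measureReal_biUnion_finset, Finset.mul_sum]
  · refine Finset.sum_congr rfl fun x _ => ?_
    have hprod : P.real (⋂ s : Fin n × Fin n, X s.1 s.2 ⁻¹' {x s.1 s.2}) =
        ∏ s : Fin n × Fin n, P.real (X s.1 s.2 ⁻¹' {x s.1 s.2}) := by
      rw [Measure.real, hindep.meas_iInter fun s => ⟨{x s.1 s.2}, trivial, rfl⟩,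
        ENNReal.toReal_prod]
      rfl
    rw [hprod, Fintype.prod_prod_type, ← Finset.prod_mul_distrib]
    refine Finset.prod_congr rfl fun i _ => ?_
    rw [← Finset.prod_mul_distrib]
    exact Finset.prod_congr rfl fun j _ => hgeom i j _
  · intro x _ y _ hxy
    refine Set.disjoint_left.2 fun ω hx hy => hxy ?_
    simp only [Set.mem_iInter, Set.mem_preimage, Set.mem_singleton_iff, Prod.forall] at hx hy
    funext i j
    rw [← hx, ← hy]
  · exact fun x _ => MeasurableSet.iInter fun s => hmeas _ _ (measurableSet_singleton _)

end JohanssonModel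

theorem mainTheorem6 {Ω : Type*} [MeasurableSpace Ω]
    (P : MeasureTheory.Measure Ω) [MeasureTheory.IsProbabilityMeasure P]
    (n : ℕ) [NeZero n] (a b : Fin n → ℝ)
    (hab : ∀ i j, 0 ≤ a i * b j ∧ a i * b j < 1)
    (X : Fin n → Fin n → Ω → ℕ)
    (hmeas : ∀ i j, Measurable (X i j))
    (hindep : ProbabilityTheory.iIndepFun (fun s : Fin n × Fin n => X s.1 s.2) P)
    (hgeom : ∀ i j k, P.real {ω | X i j ω = k} = (1 - a i * b j) * (a i * b j) ^ k)
    (l : ℕ) :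
    ((P.real {ω | JohanssonModel.lastPassageTime (fun i j => X i j ω) ≤ l} : ℝ) : ℂ) =
      (∏ i : Fin n, ∏ j : Fin n, (1 - (a i : ℂ) * (b j : ℂ))) *
        JohanssonModel.unitaryAverage l (fun θ =>
          ∏ j : Fin n, ∏ k : Fin l,
            (1 + (a j : ℂ) * Complex.exp (-(Complex.I * (θ k : ℂ)))) *
              (1 + (b j : ℂ) * Complex.exp (Complex.I * (θ k : ℂ)))) := by
  rw [JohanssonModel.measureReal_lastPassageTime_le P n a b X hmeas hindep hgeom l]
  -- Chain weights take parameters indexed by `ℕ`; the value `0` beyond `n` is never used.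
  let extend : (Fin n → ℝ) → ℕ → ℂ := fun c i => if h : i < n then (c ⟨i, h⟩ : ℂ) else 0
  have hextend : ∀ c (i : Fin n), (c i : ℂ) = extend c i := fun c i => by simp [extend]
  push_cast
  congr 1
  simp only [hextend]
  rw [JohanssonModel.unitaryAverage_eq_sum_stripChains, YoungDiagram.sum_growth_eq_sum_stripChains
    (l := l)]
  intro x
  rw [JohanssonModel.mem_boundedMatrices, JohanssonModel.lastPassageTime_eq_rowLen_growth]
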